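/- Let $K$ be a field that is complete with respect to a nontrivial non-archimedean absolute value, let $m\ge 1$, and equip $K^m$ and $M_m(K)$ with the maximum norms $\|\cdot\|$ of the entries. Let $f:K^m\to K^m$ and $x^\star\in K^m$ be such that $f(x^\star)=0$, $f$ is strictly differentiable at $x^\star$ with invertible Jacobian matrix $f'(x^\star)$, and there are a neighbourhood $U$ of $x^\star$ and a constant $c_0>0$ with $$\|f(x)-f(y)-f'(x^\star)(x-y)\|\le c_0\|x-y\|^2\qquad\text{for all }x,y\in U.$$ Given $x_0\in K^m$ and $B_0\in M_m(K)$, the non-archimedean Broyden method produces sequences $(x_n)$ and $(B_n)$ by $$x_{n+1}=x_n-B_n^{-1}f(x_n),\qquad B_{n+1}=B_n+(y_n-B_ns_n)\,u_n^{t},\qquad u_n=s_{n,l}^{-1}e_l,$$ where $s_n=x_{n+1}-x_n$, $y_n=f(x_{n+1})-f(x_n)$, $e_1,\dots,e_m$ is the canonical basis of $K^m$, and $l=l(n)$ is any index with $|s_{n,l}|=\|s_n\|$ (for instance the smallest one); if $f(x_n)=0$, both sequences are constant from index $n$ on. Then the method converges locally to $x^\star$ with R-order at least $2^{1/(2m)}$: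 there are $\eta>0$ and $\delta>0$ such that, whenever $\|x_0-x^\star\|<\eta$ and $\|B_0-f'(x^\star)\|<\delta$, for every choice of the indices $l(n)$, all the matrices $B_n$ are invertible (so the sequences are well defined), $x_n\to x^\star$, and $$\limsup_{k\to\infty}\|x_k-x^\star\|^{1/\mu^k}<1,\qquad \mu=2^{1/(2m)}.$$ -/

import Mathlib

open Filter Topology

/- Matrices carry the norm "maximum of the absolute values of the entries". -/
attribute [local instance] Matrix.normedAddCommGroup

section Broyden

variable {K : Type*} [NontriviallyNormedField K] {m : ℕ}

/-- The vector `s_l⁻¹ e_l`, where `e_l` is the `l`-th vector of the canonical basis. -/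
def pivotVector (s : Fin m → K) (l : Fin m) : Fin m → K :=
  (s l)⁻¹ • Pi.single l 1

/-- The rank-one secant update `B + (y - B s) uᵗ` of a matrix `B`. -/
def secantUpdate (B : Matrix (Fin m) (Fin m) K) (s y u : Fin m → K) :
    Matrix (Fin m) (Fin m) K :=
  B + Matrix.vecMulVec (y - B.mulVec s) u

/-- `x n`, `B n` are the iterates of the non-archimedean Broyden method applied to `f`, started
from `x 0`, `B 0`. With `s_n = x_{n+1} - x_n` and `y_n = f (x_{n+1}) - f (x_n)`, the update vector
is `u_n = s_{n,l}⁻¹ e_l`, where `l` is an index of an entry of maximal absolute value of `s_n`.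
If `f (x_n) = 0`, both sequences are constant from then on.

`(B n)⁻¹` is the inverse of a matrix; that all the `B n` met are invertible is not part of this
definition, and has to be asserted separately. -/
structure IsBroydenIteration (f : (Fin m → K) → (Fin m → K))
    (x : ℕ → Fin m → K) (B : ℕ → Matrix (Fin m) (Fin m) K) : Prop where
  step : ∀ n, x (n + 1) = x n - ((B n)⁻¹).mulVec (f (x n))
  update : ∀ n, f (x n) ≠ 0 → ∃ l : Fin m,
    ‖(x (n + 1) - x n) l‖ = ‖x (n + 1) - x n‖ ∧
    B (n + 1) = secantUpdate (B n) (x (n + 1) - x n) (f (x (n + 1)) - f (x n))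
      (pivotVector (x (n + 1) - x n) l)
  stationary : ∀ n, f (x n) = 0 → x (n + 1) = x n ∧ B (n + 1) = B n

/-- The sequence `x` converges to `a` with R-order (at least) `μ`:
`x k → a` and `limsup ‖x k - a‖ ^ (1 / μ ^ k) < 1`. The upper limit is taken in `[0, ∞]`. -/
def HasROrder (x : ℕ → Fin m → K) (a : Fin m → K) (μ : ℝ) : Prop :=
  Tendsto x atTop (𝓝 a) ∧
    limsup (fun k : ℕ => ‖x k - a‖ₑ ^ (1 / μ ^ k)) atTop < 1

end Broyden

/-!
Multiplying `f` and all `B n` by `J⁻¹` does not change the iterates, so `J` may be taken to be the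
identity. Let `g k = f (x k)`, whose norm is the distance of `x k` to the zero. The ultrametric
inequality gives linear convergence and keeps the `B n` within `1 / 2` of the identity
(`IsNearIdentity.norm_sub_lt_and_norm_sub_one_le`), hence invertible and isometric.

The order of convergence comes from `2m`-step quadratic convergence, `‖g (n + 2m)‖ ≤ c ‖g n‖²`
(`norm_add_two_mul_finrank_le`). Put `G k = (B k - 1) (B k)⁻¹`. If `f` were affine, then
`g (k + 1) = G k (g k)`, and `G (k + 1)` would be `G k` composed with a projection `v ↦ v - a • y`
with kernel spanned by `y = g (k + 1) - g k`, where `a` depends on `v`.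
Let `V` be a subspace that contains `g k` and is stable under `G k`. Then `y ∈ V`, so `V` is
stable under `G (k + 1)` too, and `G (k + 1) V`, which contains `g (k + 2)` and is stable under
`G (k + 2)`, has smaller dimension than `V` because `G (k + 1)` kills the nonzero vector `y` of
`V`. Starting with the whole space, after `2m` steps nothing is left and the residual vanishes.

For a general `f` these relations hold up to errors of norm at most `ρ = c ‖g n‖²`, provided that
they are applied to vectors no longer than the residual. In the ultrametric setting such errors do
not accumulate: the ball of radius `ρ` is a module over the unit ball of `K`, and the argument can
be run modulo it. Subspaces are replaced by modules `L` over the unit ball, truncated at the norm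
of the current residual (`IsTrapping`). Truncation makes the coefficient `a` above have norm at
most `1`, and makes `y` a longest vector of `L`, which is what lets the rank drop
(`ApproxRankLE.image`, `IsTrapping.exists_two_steps`).
-/

/-! ### Approximate rank and subspaces trapping the secant dynamics -/

section Trapping

variable {K V : Type*} [NormedField K] [NormedAddCommGroup V] [NormedSpace K V]

/-- A set `L` has rank at most `d` up to errors of norm `ρ`: any `d + 1` of its members satisfy a
linear relation modulo the ball of radius `ρ`, with coefficients normalized to have maximum
absolute value `1`. -/
def ApproxRankLE (K : Type*) {V : Type*} [NormedField K] [NormedAddCommGroup V] [NormedSpace K V]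
    (ρ : ℝ) (d : ℕ) (L : Set V) : Prop :=
  ∀ z : Fin (d + 1) → V, (∀ i, z i ∈ L) →
    ∃ c : Fin (d + 1) → K, (∀ i, ‖c i‖ ≤ 1) ∧ (∃ i, ‖c i‖ = 1) ∧ ‖∑ i, c i • z i‖ ≤ ρ

/-- One step of a secant method, seen in the space of residuals. Here `g`, `g'` are the residuals
before and after the step, and `G`, `G'` are `(B - 1) B⁻¹` for the two approximations `B` of the
Jacobian matrix, normalized to be the identity. For an affine function the fields `residual`,
`secant` and `update` hold with `c = 0`; the last one says that `G'` is `G` composed with a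
projection along `g' - g`. -/
structure IsSecantStep (c : ℝ) (g g' : V) (G G' : V →ₗ[K] V) : Prop where
  contract : ∀ z, ‖G z‖ ≤ ‖z‖
  contract' : ∀ z, ‖G' z‖ ≤ ‖z‖
  lt : ‖g'‖ < ‖g‖
  residual : ‖g' - G g‖ ≤ c * ‖g‖ ^ 2
  secant : ‖G' (g' - g)‖ ≤ c * ‖g‖ ^ 2
  update : ∀ z, ∃ a : K, ‖a‖ * ‖g‖ ≤ ‖z‖ ∧ ‖G' z - G (z - a • (g' - g))‖ ≤ c * ‖g‖ * ‖z‖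

/-- `L` is a module over the unit ball of `K` which contains the residual `g` and the ball of
radius `ρ`, lies in the ball of radius `‖g‖`, is stable under `G`, and has rank at most `d` up
to `ρ`. -/
structure IsTrapping (ρ : ℝ) (d : ℕ) (g : V) (G : V →ₗ[K] V) (L : Set V) : Prop where
  add_mem : ∀ {z w}, z ∈ L → w ∈ L → z + w ∈ L
  smul_mem : ∀ {a : K} {z}, ‖a‖ ≤ 1 → z ∈ L → a • z ∈ L
  mem_of_norm_le : ∀ {z}, ‖z‖ ≤ ρ → z ∈ L
  norm_le : ∀ {z}, z ∈ L → ‖z‖ ≤ ‖g‖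
  mem : g ∈ L
  map_mem : ∀ {z}, z ∈ L → G z ∈ L
  rank : ApproxRankLE K ρ d L

theorem IsTrapping.sub_mem {ρ : ℝ} {d : ℕ} {g : V} {G : V →ₗ[K] V} {L : Set V}
    (h : IsTrapping ρ d g G L) {z w : V} (hz : z ∈ L) (hw : w ∈ L) : z - w ∈ L := by
  have := h.add_mem hz (h.smul_mem (a := -1) (by simp) hw)
  simpa [sub_eq_add_neg] using this

theorem approxRankLE_finrank [FiniteDimensional K V] {ρ : ℝ} (hρ : 0 ≤ ρ) (L : Set V) :
    ApproxRankLE K ρ (Module.finrank K V) L := by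
  intro z _
  have hz : ¬ LinearIndependent K z := fun h => by
    simpa using h.fintype_card_le_finrank
  obtain ⟨c, hc, i, hi⟩ := Fintype.not_linearIndependent_iff.1 hz
  obtain ⟨j, hj⟩ := Finite.exists_max fun i => ‖c i‖
  have hpos : 0 < ‖c j‖ := (norm_pos_iff.2 hi).trans_le (hj i)
  refine ⟨fun i => (c j)⁻¹ * c i, fun i => ?_, ⟨j, ?_⟩, ?_⟩
  · rw [norm_mul, norm_inv, inv_mul_le_iff₀ hpos, mul_one]
    exact hj i
  · rw [norm_mul, norm_inv, inv_mul_cancel₀ hpos.ne']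
  · simp only [mul_smul]
    rw [← Finset.smul_sum, hc]
    simpa using hρ

theorem IsSecantStep.norm_sub [IsUltrametricDist V] {c : ℝ} {g g' : V} {G G' : V →ₗ[K] V}
    (h : IsSecantStep c g g' G G') : ‖g' - g‖ = ‖g‖ := by
  rw [sub_eq_add_neg, IsUltrametricDist.norm_add_eq_max_of_norm_ne_norm, norm_neg,
    max_eq_right h.lt.le]
  rw [norm_neg]
  exact h.lt.ne

theorem norm_sum_smul_le [IsUltrametricDist V] {ι : Type*} [Fintype ι] {c : ι → K}
    {z : ι → V} {r : ℝ} (hr : 0 ≤ r) (hc : ∀ i, ‖c i‖ ≤ 1) (hz : ∀ i, ‖z i‖ ≤ r) :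
    ‖∑ i, c i • z i‖ ≤ r :=
  IsUltrametricDist.norm_sum_le_of_forall_le_of_nonneg hr fun i _ => by
    rw [norm_smul]
    exact (mul_le_of_le_one_left (norm_nonneg _) (hc i)).trans (hz i)

/-- A vector of maximal norm in `L`, longer than `ρ` but mapped by `G` into the ball of radius `ρ`,
makes the rank of the image `G L` drop. -/
theorem ApproxRankLE.image [IsUltrametricDist V] {ρ : ℝ} {d : ℕ} {L : Set V}
    (h : ApproxRankLE K ρ (d + 1) L) (hρ : 0 ≤ ρ) {G : V →ₗ[K] V} (hG : ∀ z, ‖G z‖ ≤ ‖z‖)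
    {y : V} (hyL : y ∈ L) (hy : ‖G y‖ ≤ ρ) (hyρ : ρ < ‖y‖) (hL : ∀ z ∈ L, ‖z‖ ≤ ‖y‖) :
    ApproxRankLE K ρ d {w | ∃ z ∈ L, ‖w - G z‖ ≤ ρ} := by
  intro w hw
  choose z hz hwz using hw
  obtain ⟨c, hc, ⟨i₀, hi₀⟩, hsum⟩ := h (Fin.cons y z) fun i => by
    refine Fin.cases ?_ (fun i => ?_) i
    · simpa using hyL
    · simpa using hz i
  rw [Fin.sum_univ_succ] at hsum
  simp only [Fin.cons_zero, Fin.cons_succ] at hsum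
  refine ⟨fun i => c i.succ, fun i => hc _, ?_, ?_⟩
  · -- Otherwise the relation expresses `y` as a combination with coefficients of norm `< 1` of
    -- vectors that are no longer than `y`, up to an error shorter than `y`.
    by_contra! hne
    have hlt : ∀ i : Fin (d + 1), ‖c i.succ‖ < 1 := fun i => lt_of_le_of_ne (hc _) (hne i)
    have hc0 : ‖c 0‖ = 1 := by
      revert hi₀
      refine Fin.cases (fun h => h) (fun i hi => absurd hi (hne i)) i₀
    have hy0 : 0 < ‖y‖ := hρ.trans_lt hyρ
    obtain ⟨j, hj⟩ := Finite.exists_max fun i : Fin (d + 1) => ‖c i.succ‖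
    have h1 : ‖∑ i : Fin (d + 1), c i.succ • z i‖ ≤ ‖c j.succ‖ * ‖y‖ :=
      IsUltrametricDist.norm_sum_le_of_forall_le_of_nonneg (by positivity) fun i _ => by
        rw [norm_smul]
        exact mul_le_mul (hj i) (hL _ (hz i)) (norm_nonneg _) (norm_nonneg _)
    have h2 : ‖∑ i : Fin (d + 1), c i.succ • z i‖ < ‖y‖ :=
      h1.trans_lt (mul_lt_of_lt_one_left hy0 (hlt j))
    have h3 : ‖c 0 • y‖ = ‖y‖ := by rw [norm_smul, hc0, one_mul]
    rw [IsUltrametricDist.norm_add_eq_max_of_norm_ne_norm (by rw [h3]; exact h2.ne'), h3] at hsum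
    exact absurd ((le_max_left _ _).trans hsum) hyρ.not_ge
  · have hdec : ∑ i : Fin (d + 1), c i.succ • w i
        = (∑ i : Fin (d + 1), c i.succ • (w i - G (z i)))
          + (G (c 0 • y + ∑ i : Fin (d + 1), c i.succ • z i) - c 0 • G y) := by
      simp [smul_sub, Finset.sum_sub_distrib, map_sum]
    rw [hdec]
    refine (IsUltrametricDist.norm_add_le_max _ _).trans
      (max_le (norm_sum_smul_le hρ (fun i => hc _) hwz) ?_)
    rw [sub_eq_add_neg]
    refine (IsUltrametricDist.norm_add_le_max _ _).trans (max_le ((hG _).trans hsum) ?_)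
    rw [norm_neg, norm_smul]
    exact (mul_le_of_le_one_left (norm_nonneg _) (hc 0)).trans hy

theorem IsSecantStep.residual_mem {c ρ : ℝ} {d : ℕ} {g g' : V} {G G' : V →ₗ[K] V} {L : Set V}
    (hs : IsSecantStep c g g' G G') (hL : IsTrapping ρ d g G L) (hc : c * ‖g‖ ^ 2 ≤ ρ) :
    g' ∈ L := by
  have := hL.add_mem (hL.mem_of_norm_le (hs.residual.trans hc)) (hL.map_mem hL.mem)
  simpa using this

/-- On a vector of `L` no longer than the residual, `G'` agrees up to `ρ` with `G` at another vector
of `L`: the bound on the vector makes the coefficient of `g' - g` in `update` at most `1`. -/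
theorem IsSecantStep.exists_norm_sub_le {c ρ : ℝ} {d : ℕ} {g₀ g g' : V}
    {G₀ G G' : V →ₗ[K] V} {L : Set V} (hs : IsSecantStep c g g' G G')
    (hL : IsTrapping ρ d g₀ G₀ L) (hc0 : 0 ≤ c) (hc : c * ‖g‖ ^ 2 ≤ ρ)
    (hy : g' - g ∈ L) {z : V} (hz : z ∈ L) (hzg : ‖z‖ ≤ ‖g‖) :
    ∃ w ∈ L, ‖G' z - G w‖ ≤ ρ := by
  obtain ⟨a, ha, hau⟩ := hs.update z
  have hg : 0 < ‖g‖ := (norm_nonneg _).trans_lt hs.lt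
  have ha1 : ‖a‖ ≤ 1 := by
    by_contra! h
    nlinarith
  refine ⟨_, hL.sub_mem hz (hL.smul_mem ha1 hy), hau.trans (le_trans ?_ hc)⟩
  rw [pow_two, ← mul_assoc]
  gcongr

/-- Two consecutive secant steps lower the rank of a trapping module: the new module is the part
of `G₁ L` of norm at most that of the new residual. The rank drops because `G₁` kills
`g₁ - g₀ ∈ L`. -/
theorem IsTrapping.exists_two_steps [IsUltrametricDist V] {c ρ : ℝ} {d : ℕ} {g₀ g₁ g₂ : V}
    {G₀ G₁ G₂ : V →ₗ[K] V} {L : Set V} (hL : IsTrapping ρ (d + 1) g₀ G₀ L)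
    (h₁ : IsSecantStep c g₀ g₁ G₀ G₁) (h₂ : IsSecantStep c g₁ g₂ G₁ G₂)
    (hc0 : 0 ≤ c) (hc : c * ‖g₀‖ ^ 2 ≤ ρ) (hρ : ρ < ‖g₂‖) :
    ∃ L', IsTrapping ρ d g₂ G₂ L' := by
  have hρ0 : 0 ≤ ρ := le_trans (by positivity) hc
  have hc1 : c * ‖g₁‖ ^ 2 ≤ ρ := le_trans (by gcongr; exact h₁.lt.le) hc
  have hy0 : g₁ - g₀ ∈ L := hL.sub_mem (h₁.residual_mem hL hc) hL.mem
  have hg1 : g₁ ∈ L := h₁.residual_mem hL hc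
  have hzero : (0 : V) ∈ L := hL.mem_of_norm_le (by simpa using hρ0)
  have hmap : ∀ {z}, z ∈ L → G₁ z ∈ L := fun {z} hz => by
    obtain ⟨w, hw, hzw⟩ := h₁.exists_norm_sub_le hL hc0 hc hy0 hz (hL.norm_le hz)
    simpa using hL.add_mem (hL.mem_of_norm_le hzw) (hL.map_mem hw)
  have hsub : ∀ {w z}, z ∈ L → ‖w - G₁ z‖ ≤ ρ → w ∈ L := fun hz hw => by
    simpa using hL.add_mem (hL.mem_of_norm_le hw) (hmap hz)
  have hg2 : g₂ ∈ L := hsub hg1 (h₂.residual.trans hc1)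
  have hy1 : g₂ - g₁ ∈ L := hL.sub_mem hg2 hg1
  have hrank : ApproxRankLE K ρ d {w | ∃ z ∈ L, ‖w - G₁ z‖ ≤ ρ} :=
    hL.rank.image hρ0 h₂.contract hy0 (h₁.secant.trans hc)
      (by rw [h₁.norm_sub]; exact hρ.trans (h₂.lt.trans h₁.lt))
      fun z hz => by rw [h₁.norm_sub]; exact hL.norm_le hz
  refine ⟨{w | ‖w‖ ≤ ‖g₂‖ ∧ ∃ z ∈ L, ‖w - G₁ z‖ ≤ ρ}, ?_, ?_, ?_, fun h => h.1, ?_, ?_, ?_⟩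
  · rintro w w' ⟨hw, z, hz, hwz⟩ ⟨hw', z', hz', hwz'⟩
    refine ⟨(IsUltrametricDist.norm_add_le_max _ _).trans (max_le hw hw'), z + z',
      hL.add_mem hz hz', ?_⟩
    rw [map_add, add_sub_add_comm]
    exact (IsUltrametricDist.norm_add_le_max _ _).trans (max_le hwz hwz')
  · rintro a w ha ⟨hw, z, hz, hwz⟩
    refine ⟨?_, a • z, hL.smul_mem ha hz, ?_⟩
    · rw [norm_smul]
      exact (mul_le_of_le_one_left (norm_nonneg _) ha).trans hw
    · rw [map_smul, ← smul_sub, norm_smul]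
      exact (mul_le_of_le_one_left (norm_nonneg _) ha).trans hwz
  · intro w hw
    exact ⟨hw.trans hρ.le, 0, hzero, by simpa using hw⟩
  · exact ⟨le_rfl, g₁, hg1, h₂.residual.trans hc1⟩
  · rintro w ⟨hw, z, hz, hwz⟩
    exact ⟨(h₂.contract' w).trans hw,
      h₂.exists_norm_sub_le hL hc0 hc1 hy1 (hsub hz hwz) (hw.trans h₂.lt.le)⟩
  · exact fun z hz => hrank z fun i => (hz i).2

/-- The `2m`-step quadratic decrease of the residuals: in dimension `m` the rank of the trapping
modules is exhausted after `m` pairs of steps. -/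
theorem norm_add_two_mul_finrank_le [IsUltrametricDist V] [FiniteDimensional K V] {c : ℝ}
    (hc : 0 ≤ c) {g : ℕ → V} {G : ℕ → V →ₗ[K] V}
    (hstep : ∀ k, g k ≠ 0 → IsSecantStep c (g k) (g (k + 1)) (G k) (G (k + 1)))
    (hanti : Antitone fun k => ‖g k‖) (n : ℕ) :
    ‖g (n + 2 * Module.finrank K V)‖ ≤ c * ‖g n‖ ^ 2 := by
  set ρ := c * ‖g n‖ ^ 2 with hρ
  have hρ0 : 0 ≤ ρ := by positivity
  have key : ∀ j d, j + d = Module.finrank K V →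
      ‖g (n + 2 * j)‖ ≤ ρ ∨ ∃ L, IsTrapping ρ d (g (n + 2 * j)) (G (n + 2 * j)) L := by
    intro j
    induction j with
    | zero =>
      intro d hd
      rcases le_or_gt ‖g n‖ ρ with h | h
      · exact Or.inl h
      have hg : g n ≠ 0 := norm_pos_iff.1 (hρ0.trans_lt h)
      refine Or.inr ⟨{z | ‖z‖ ≤ ‖g n‖}, ?_, ?_, fun hz => le_trans hz h.le, fun h => h,
        le_refl ‖g n‖, fun {z} hz => ((hstep n hg).contract z).trans hz, ?_⟩
      · exact fun hz hw => (IsUltrametricDist.norm_add_le_max _ _).trans (max_le hz hw)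
      · intro a z ha hz
        rw [Set.mem_ofPred_eq, norm_smul]
        exact (mul_le_of_le_one_left (norm_nonneg _) ha).trans hz
      · rw [zero_add] at hd
        rw [hd]
        exact approxRankLE_finrank hρ0 _
    | succ j ih =>
      intro d hd
      rcases le_or_gt ‖g (n + 2 * (j + 1))‖ ρ with h | h
      · exact Or.inl h
      have h1 : ρ < ‖g (n + 2 * j + 1)‖ := h.trans_le (hanti (by omega))
      have h0 : ρ < ‖g (n + 2 * j)‖ := h1.trans_le (hanti (by omega))
      obtain ⟨L, hL⟩ := (ih (d + 1) (by omega)).resolve_left h0.not_ge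
      refine Or.inr (hL.exists_two_steps (hstep _ (norm_pos_iff.1 (hρ0.trans_lt h0)))
        (hstep _ (norm_pos_iff.1 (hρ0.trans_lt h1))) hc ?_ h)
      rw [hρ]
      gcongr
      exact hanti (by omega)
  rcases key _ 0 (add_zero _) with h | ⟨L, hL⟩
  · exact h
  · obtain ⟨a, -, ⟨i, hi⟩, ha⟩ := hL.rank (fun _ => g (n + 2 * Module.finrank K V))
      fun _ => hL.mem
    rw [Fin.fin_one_eq_zero i] at hi
    simpa [norm_smul, hi] using ha

end Trapping

/-! ### Ultrametric estimates for matrices with the maximum norm -/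

section Matrix

variable {K : Type*} [NontriviallyNormedField K] {m : ℕ}

theorem Matrix.mulVec_inv_mulVec_of_isUnit {B : Matrix (Fin m) (Fin m) K} (hB : IsUnit B)
    (v : Fin m → K) : B.mulVec (B⁻¹.mulVec v) = v := by
  rw [Matrix.mulVec_mulVec, Matrix.mul_nonsing_inv _ ((Matrix.isUnit_iff_isUnit_det B).1 hB),
    Matrix.one_mulVec]

theorem Matrix.inv_mulVec_mulVec_of_isUnit {B : Matrix (Fin m) (Fin m) K} (hB : IsUnit B)
    (v : Fin m → K) : B⁻¹.mulVec (B.mulVec v) = v := by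
  rw [Matrix.mulVec_mulVec, Matrix.nonsing_inv_mul _ ((Matrix.isUnit_iff_isUnit_det B).1 hB),
    Matrix.one_mulVec]

theorem norm_pivotVector (s : Fin m → K) (l : Fin m) : ‖pivotVector s l‖ = ‖s l‖⁻¹ := by
  rw [pivotVector, norm_smul, norm_inv, Pi.norm_single, norm_one, mul_one]

theorem pivotVector_dotProduct (s v : Fin m → K) (l : Fin m) :
    pivotVector s l ⬝ᵥ v = (s l)⁻¹ * v l := by
  simp [pivotVector]

theorem secantUpdate_mulVec (B : Matrix (Fin m) (Fin m) K) (s y v : Fin m → K) (l : Fin m) :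
    (secantUpdate B s y (pivotVector s l)).mulVec v
      = B.mulVec v + ((s l)⁻¹ * v l) • (y - B.mulVec s) := by
  rw [secantUpdate, Matrix.add_mulVec, Matrix.vecMulVec_mulVec, pivotVector_dotProduct]
  ext i
  simp only [Pi.add_apply, Pi.smul_apply, MulOpposite.smul_eq_mul_unop, MulOpposite.unop_op,
    smul_eq_mul]
  ring

variable [IsUltrametricDist K]

theorem Matrix.norm_mulVec_le_of_ultrametric (A : Matrix (Fin m) (Fin m) K) (v : Fin m → K) :
    ‖A.mulVec v‖ ≤ ‖A‖ * ‖v‖ := by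
  rw [pi_norm_le_iff_of_nonneg (by positivity)]
  intro i
  change ‖∑ j, A i j * v j‖ ≤ ‖A‖ * ‖v‖
  refine IsUltrametricDist.norm_sum_le_of_forall_le_of_nonneg
    (by positivity) fun j _ => ?_
  rw [norm_mul]
  exact mul_le_mul (A.norm_entry_le_entrywise_sup_norm) (norm_le_pi_norm v j) (norm_nonneg _)
    (norm_nonneg _)

theorem Matrix.norm_mul_le_of_ultrametric (A B : Matrix (Fin m) (Fin m) K) :
    ‖A * B‖ ≤ ‖A‖ * ‖B‖ := by
  rw [Matrix.norm_le_iff (by positivity)]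
  intro i j
  change ‖∑ k, A i k * B k j‖ ≤ ‖A‖ * ‖B‖
  refine IsUltrametricDist.norm_sum_le_of_forall_le_of_nonneg
    (by positivity) fun k _ => ?_
  rw [norm_mul]
  exact mul_le_mul (A.norm_entry_le_entrywise_sup_norm) (B.norm_entry_le_entrywise_sup_norm)
    (norm_nonneg _) (norm_nonneg _)

theorem Matrix.norm_add_vecMulVec_le (A : Matrix (Fin m) (Fin m) K) (v w : Fin m → K) :
    ‖A + Matrix.vecMulVec v w‖ ≤ max ‖A‖ (‖v‖ * ‖w‖) := by
  rw [Matrix.norm_le_iff (le_max_of_le_left (norm_nonneg _))]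
  intro i j
  refine (IsUltrametricDist.norm_add_le_max _ _).trans
    (max_le_max A.norm_entry_le_entrywise_sup_norm ?_)
  rw [Matrix.vecMulVec_apply, norm_mul]
  exact mul_le_mul (norm_le_pi_norm v i) (norm_le_pi_norm w j) (norm_nonneg _) (norm_nonneg _)

theorem Matrix.norm_mulVec_of_norm_sub_one_lt {B : Matrix (Fin m) (Fin m) K} (hB : ‖B - 1‖ < 1)
    (v : Fin m → K) : ‖B.mulVec v‖ = ‖v‖ := by
  rcases eq_or_ne v 0 with rfl | hv
  · simp
  have hv' : 0 < ‖v‖ := norm_pos_iff.2 hv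
  have h : ‖(B - 1).mulVec v‖ < ‖v‖ :=
    ((B - 1).norm_mulVec_le_of_ultrametric v).trans_lt (mul_lt_of_lt_one_left hv' hB)
  have hdec : B.mulVec v = v + (B - 1).mulVec v := by
    rw [Matrix.sub_mulVec, Matrix.one_mulVec]; abel
  rw [hdec, IsUltrametricDist.norm_add_eq_max_of_norm_ne_norm h.ne', max_eq_left h.le]

theorem Matrix.isUnit_of_norm_sub_one_lt {B : Matrix (Fin m) (Fin m) K} (hB : ‖B - 1‖ < 1) :
    IsUnit B := by
  rw [← Matrix.mulVec_injective_iff_isUnit]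
  intro v w hvw
  have h := Matrix.norm_mulVec_of_norm_sub_one_lt hB (v - w)
  rw [Matrix.mulVec_sub, sub_eq_zero.2 hvw, norm_zero] at h
  exact sub_eq_zero.1 (norm_eq_zero.1 h.symm)

theorem Matrix.norm_inv_mulVec_of_norm_sub_one_lt {B : Matrix (Fin m) (Fin m) K}
    (hB : ‖B - 1‖ < 1) (v : Fin m → K) : ‖B⁻¹.mulVec v‖ = ‖v‖ := by
  rw [← Matrix.norm_mulVec_of_norm_sub_one_lt hB,
    Matrix.mulVec_inv_mulVec_of_isUnit (Matrix.isUnit_of_norm_sub_one_lt hB)]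

end Matrix

/-! ### The Broyden iteration with Jacobian matrix the identity -/

section Normalized

variable {K : Type*} [NontriviallyNormedField K] {m : ℕ}

/-- The Broyden iteration is invariant under multiplication of the equation by an invertible
matrix. -/
theorem IsBroydenIteration.const_mul {f : (Fin m → K) → (Fin m → K)} {x : ℕ → Fin m → K}
    {B : ℕ → Matrix (Fin m) (Fin m) K} (h : IsBroydenIteration f x B)
    {A : Matrix (Fin m) (Fin m) K} (hA : IsUnit A) :
    IsBroydenIteration (fun z => A.mulVec (f z)) x (fun n => A * B n) := by
  have hne : ∀ v, A.mulVec v = 0 ↔ v = 0 := fun v =>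
    ⟨fun hv => Matrix.mulVec_injective_of_isUnit hA (by simpa using hv), fun hv => by simp [hv]⟩
  refine ⟨fun n => ?_, fun n hn => ?_, fun n hn => ?_⟩
  · rw [h.step n, Matrix.mul_inv_rev, Matrix.mulVec_mulVec, Matrix.mul_assoc,
      Matrix.nonsing_inv_mul _ ((Matrix.isUnit_iff_isUnit_det A).1 hA), Matrix.mul_one]
  · obtain ⟨l, hl, hB⟩ := h.update n fun h0 => hn ((hne _).2 h0)
    refine ⟨l, hl, ?_⟩
    rw [hB, secantUpdate, secantUpdate, Matrix.mul_add, Matrix.mul_vecMulVec, Matrix.mulVec_sub,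
      Matrix.mulVec_sub, Matrix.mulVec_mulVec]
  · obtain ⟨hx, hB⟩ := h.stationary n ((hne _).1 hn)
    exact ⟨hx, by rw [hB]⟩

variable {f : (Fin m → K) → (Fin m → K)} {a : Fin m → K} {c r : ℝ}

/-- `f` differs from a translation near its zero `a` by a quadratically small error, on a ball of
radius `r` so small that the error, measured from `a`, is at most half the distance to `a`. -/
structure IsNearIdentity (f : (Fin m → K) → (Fin m → K)) (a : Fin m → K) (c r : ℝ) : Prop where
  nonneg : 0 ≤ c
  mul_le : c * r ≤ 1 / 2
  zero : f a = 0
  quad : ∀ x y, ‖x - a‖ < r → ‖y - a‖ < r → ‖f x - f y - (x - y)‖ ≤ c * ‖x - y‖ ^ 2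

theorem IsNearIdentity.norm_sub_le (h : IsNearIdentity f a c r) {x : Fin m → K}
    (hx : ‖x - a‖ < r) : ‖f x - (x - a)‖ ≤ 1 / 2 * ‖x - a‖ := by
  have h1 := h.quad x a hx (by simpa using (norm_nonneg _).trans_lt hx)
  rw [h.zero, sub_zero] at h1
  refine h1.trans ?_
  rw [pow_two, ← mul_assoc]
  gcongr
  exact (mul_le_mul_of_nonneg_left hx.le h.nonneg).trans h.mul_le

/-- The operator `(B - 1) B⁻¹` on residuals. -/
noncomputable def residualMap (B : Matrix (Fin m) (Fin m) K) : (Fin m → K) →ₗ[K] (Fin m → K) :=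
  Matrix.mulVecLin ((B - 1) * B⁻¹)

theorem residualMap_apply (B : Matrix (Fin m) (Fin m) K) (v : Fin m → K) :
    residualMap B v = (B - 1).mulVec (B⁻¹.mulVec v) := by
  rw [residualMap, Matrix.mulVecLin_apply, Matrix.mulVec_mulVec]

theorem residualMap_mulVec {B : Matrix (Fin m) (Fin m) K} (hB : IsUnit B) (v : Fin m → K) :
    residualMap B (B.mulVec v) = (B - 1).mulVec v := by
  rw [residualMap_apply, Matrix.inv_mulVec_mulVec_of_isUnit hB]

variable [IsUltrametricDist K]

theorem IsNearIdentity.norm_apply (h : IsNearIdentity f a c r) {x : Fin m → K}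
    (hx : ‖x - a‖ < r) : ‖f x‖ = ‖x - a‖ := by
  have h1 := h.norm_sub_le hx
  rcases eq_or_ne (x - a) 0 with h0 | h0
  · rw [h0] at h1 ⊢
    simpa using h1
  have h2 : ‖f x - (x - a)‖ < ‖x - a‖ := by
    have := norm_pos_iff.2 h0
    linarith
  have h3 := IsUltrametricDist.norm_add_eq_max_of_norm_ne_norm h2.ne
  rwa [sub_add_cancel, max_eq_right h2.le] at h3

/-- Linear convergence: one step halves the distance to the zero. -/
theorem IsNearIdentity.norm_newton_step_le (h : IsNearIdentity f a c r) {x : Fin m → K}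
    (hx : ‖x - a‖ < r) {B : Matrix (Fin m) (Fin m) K} (hB : ‖B - 1‖ ≤ 1 / 2) :
    ‖x - B⁻¹.mulVec (f x) - a‖ ≤ 1 / 2 * ‖x - a‖ := by
  have hB1 : ‖B - 1‖ < 1 := hB.trans_lt (by norm_num)
  have hdec : B.mulVec (x - B⁻¹.mulVec (f x) - a)
      = (B - 1).mulVec (x - a) + -(f x - (x - a)) := by
    rw [sub_right_comm, Matrix.mulVec_sub,
      Matrix.mulVec_inv_mulVec_of_isUnit (Matrix.isUnit_of_norm_sub_one_lt hB1),
      Matrix.sub_mulVec, Matrix.one_mulVec]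
    abel
  rw [← Matrix.norm_mulVec_of_norm_sub_one_lt hB1, hdec]
  refine (IsUltrametricDist.norm_add_le_max _ _).trans (max_le ?_ ?_)
  · exact ((B - 1).norm_mulVec_le_of_ultrametric _).trans (by gcongr)
  · rw [norm_neg]
    exact h.norm_sub_le hx

/-- Bounded deterioration: the update does not take the approximation of the Jacobian matrix
farther than `1 / 2` from the identity. -/
theorem IsNearIdentity.norm_secantUpdate_sub_one_le (h : IsNearIdentity f a c r)
    {x x' : Fin m → K} (hx : ‖x - a‖ < r) (hx' : ‖x' - a‖ < r) {B : Matrix (Fin m) (Fin m) K}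
    (hB : ‖B - 1‖ ≤ 1 / 2) {l : Fin m} (hl : ‖(x' - x) l‖ = ‖x' - x‖) :
    ‖secantUpdate B (x' - x) (f x' - f x) (pivotVector (x' - x) l) - 1‖ ≤ 1 / 2 := by
  have hr : ‖x' - x‖ < r := by
    rw [← sub_sub_sub_cancel_right x' x a, sub_eq_add_neg]
    refine (IsUltrametricDist.norm_add_le_max _ _).trans_lt (max_lt hx' ?_)
    rwa [norm_neg]
  have hdec : f x' - f x - B.mulVec (x' - x)
      = (f x' - f x - (x' - x)) + -((B - 1).mulVec (x' - x)) := by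
    rw [Matrix.sub_mulVec, Matrix.one_mulVec]
    abel
  have hnum : ‖f x' - f x - B.mulVec (x' - x)‖ ≤ 1 / 2 * ‖x' - x‖ := by
    rw [hdec]
    refine (IsUltrametricDist.norm_add_le_max _ _).trans (max_le ?_ ?_)
    · refine (h.quad _ _ hx' hx).trans ?_
      rw [pow_two, ← mul_assoc]
      gcongr
      exact (mul_le_mul_of_nonneg_left hr.le h.nonneg).trans h.mul_le
    · rw [norm_neg]
      exact ((B - 1).norm_mulVec_le_of_ultrametric _).trans (by gcongr)
  rw [secantUpdate, add_sub_right_comm]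
  refine (Matrix.norm_add_vecMulVec_le _ _ _).trans (max_le hB ?_)
  rw [norm_pivotVector, hl]
  rcases eq_or_ne ‖x' - x‖ 0 with h0 | h0
  · rw [h0]; norm_num
  · calc _ ≤ 1 / 2 * ‖x' - x‖ * ‖x' - x‖⁻¹ := by gcongr
      _ = 1 / 2 := by field_simp

variable {x : ℕ → Fin m → K} {B : ℕ → Matrix (Fin m) (Fin m) K}

theorem IsNearIdentity.norm_sub_lt_and_norm_sub_one_le (h : IsNearIdentity f a c r)
    (hxB : IsBroydenIteration f x B) (hx0 : ‖x 0 - a‖ < r) (hB0 : ‖B 0 - 1‖ ≤ 1 / 2) (n : ℕ) :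
    ‖x n - a‖ < r ∧ ‖B n - 1‖ ≤ 1 / 2 := by
  induction n with
  | zero => exact ⟨hx0, hB0⟩
  | succ n ih =>
    obtain ⟨hx, hB⟩ := ih
    have hx' : ‖x (n + 1) - a‖ < r := by
      rw [hxB.step n]
      exact (h.norm_newton_step_le hx hB).trans_lt (by linarith [norm_nonneg (x n - a)])
    refine ⟨hx', ?_⟩
    by_cases hf : f (x n) = 0
    · rwa [(hxB.stationary n hf).2]
    · obtain ⟨l, hl, hBl⟩ := hxB.update n hf
      rw [hBl]
      exact h.norm_secantUpdate_sub_one_le hx hx' hB hl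

theorem norm_residualMap_le {B : Matrix (Fin m) (Fin m) K} (hB : ‖B - 1‖ < 1) (v : Fin m → K) :
    ‖residualMap B v‖ ≤ ‖v‖ := by
  rw [residualMap_apply]
  refine ((B - 1).norm_mulVec_le_of_ultrametric _).trans ?_
  rw [Matrix.norm_inv_mulVec_of_norm_sub_one_lt hB]
  exact mul_le_of_le_one_left (norm_nonneg _) hB.le

/-- The identities valid for affine functions hold up to `y - s`, the error of linearization along
the step `s`. -/
theorem IsNearIdentity.isSecantStep (h : IsNearIdentity f a c r)
    (hxB : IsBroydenIteration f x B) (hx0 : ‖x 0 - a‖ < r) (hB0 : ‖B 0 - 1‖ ≤ 1 / 2) (n : ℕ)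
    (hf : f (x n) ≠ 0) :
    IsSecantStep c (f (x n)) (f (x (n + 1))) (residualMap (B n)) (residualMap (B (n + 1))) := by
  obtain ⟨hx, hB⟩ := h.norm_sub_lt_and_norm_sub_one_le hxB hx0 hB0 n
  obtain ⟨hx', hB'⟩ := h.norm_sub_lt_and_norm_sub_one_le hxB hx0 hB0 (n + 1)
  replace hB : ‖B n - 1‖ < 1 := hB.trans_lt (by norm_num)
  replace hB' : ‖B (n + 1) - 1‖ < 1 := hB'.trans_lt (by norm_num)
  have hU := Matrix.isUnit_of_norm_sub_one_lt hB
  have hU' := Matrix.isUnit_of_norm_sub_one_lt hB'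
  obtain ⟨l, hl, hBl⟩ := hxB.update n hf
  set s := x (n + 1) - x n with hs
  set y := f (x (n + 1)) - f (x n) with hy
  have hpos : 0 < ‖f (x n)‖ := norm_pos_iff.2 hf
  have hBs : (B n).mulVec s = -f (x n) := by
    rw [hs, hxB.step n, sub_sub_cancel_left, Matrix.mulVec_neg,
      Matrix.mulVec_inv_mulVec_of_isUnit hU]
  have hsn : ‖s‖ = ‖f (x n)‖ := by
    rw [← Matrix.norm_mulVec_of_norm_sub_one_lt hB, hBs, norm_neg]
  have hr : ‖y - s‖ ≤ c * ‖f (x n)‖ ^ 2 := hsn ▸ h.quad _ _ hx' hx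
  have hsl : s l ≠ 0 := norm_pos_iff.1 (by rw [hl, hsn]; exact hpos)
  have hmul : ∀ v, (B (n + 1)).mulVec v
      = (B n).mulVec v + ((s l)⁻¹ * v l) • (y - (B n).mulVec s) := fun v => by
    rw [hBl, secantUpdate_mulVec]
  have hB's : (B (n + 1)).mulVec s = y := by
    rw [hmul, inv_mul_cancel₀ hsl, one_smul, add_sub_cancel]
  refine ⟨norm_residualMap_le hB, norm_residualMap_le hB', ?_, ?_, ?_, fun z => ?_⟩
  · rw [h.norm_apply hx] at hpos ⊢
    rw [h.norm_apply hx', hxB.step n]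
    have := h.norm_newton_step_le hx (B := B n)
      (h.norm_sub_lt_and_norm_sub_one_le hxB hx0 hB0 n).2
    linarith
  · have : f (x (n + 1)) - residualMap (B n) (f (x n)) = y - s := by
      rw [← neg_neg (f (x n)), ← hBs, map_neg, residualMap_mulVec hU, Matrix.sub_mulVec,
        Matrix.one_mulVec, hBs, hy]
      abel
    rwa [this]
  · change ‖residualMap (B (n + 1)) y‖ ≤ _
    rw [← hB's, residualMap_mulVec hU', Matrix.sub_mulVec, hB's, Matrix.one_mulVec]
    exact hr
  · -- In terms of `w = B'⁻¹ z` the coefficient is `uᵗ w`, where `u` is the pivot vector.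
    obtain ⟨w, rfl⟩ : ∃ w, z = (B (n + 1)).mulVec w :=
      ⟨_, (Matrix.mulVec_inv_mulVec_of_isUnit hU' z).symm⟩
    have ha : ‖(s l)⁻¹ * w l‖ * ‖f (x n)‖ ≤ ‖(B (n + 1)).mulVec w‖ := by
      rw [Matrix.norm_mulVec_of_norm_sub_one_lt hB', norm_mul, norm_inv, hl, hsn, mul_comm,
        mul_inv_cancel_left₀ hpos.ne']
      exact norm_le_pi_norm w l
    refine ⟨(s l)⁻¹ * w l, ha, ?_⟩
    have harg : (B (n + 1)).mulVec w - ((s l)⁻¹ * w l) • y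
        = (B n).mulVec (w - ((s l)⁻¹ * w l) • s) := by
      rw [hmul, Matrix.mulVec_sub (B n) w, Matrix.mulVec_smul, smul_sub]
      abel
    have hdiff : (B (n + 1) - 1).mulVec w - (B n - 1).mulVec (w - ((s l)⁻¹ * w l) • s)
        = ((s l)⁻¹ * w l) • (y - s) := by
      rw [Matrix.sub_mulVec, Matrix.sub_mulVec, Matrix.one_mulVec, Matrix.one_mulVec, hmul,
        Matrix.mulVec_sub (B n) w, Matrix.mulVec_smul]
      module
    rw [harg, residualMap_mulVec hU, residualMap_mulVec hU', hdiff, norm_smul]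
    calc _ ≤ ‖(s l)⁻¹ * w l‖ * (c * ‖f (x n)‖ ^ 2) := by gcongr
      _ = c * ‖f (x n)‖ * (‖(s l)⁻¹ * w l‖ * ‖f (x n)‖) := by ring
      _ ≤ _ := by
        have := h.nonneg
        gcongr

theorem IsNearIdentity.norm_iterate_succ_le (h : IsNearIdentity f a c r)
    (hxB : IsBroydenIteration f x B) (hx0 : ‖x 0 - a‖ < r) (hB0 : ‖B 0 - 1‖ ≤ 1 / 2) (n : ℕ) :
    ‖x (n + 1) - a‖ ≤ 1 / 2 * ‖x n - a‖ := by
  obtain ⟨hx, hB⟩ := h.norm_sub_lt_and_norm_sub_one_le hxB hx0 hB0 n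
  rw [hxB.step n]
  exact h.norm_newton_step_le hx hB

theorem IsNearIdentity.norm_iterate_add_two_mul_le (h : IsNearIdentity f a c r)
    (hxB : IsBroydenIteration f x B) (hx0 : ‖x 0 - a‖ < r) (hB0 : ‖B 0 - 1‖ ≤ 1 / 2) (n : ℕ) :
    ‖x (n + 2 * m) - a‖ ≤ c * ‖x n - a‖ ^ 2 := by
  have hnorm : ∀ k, ‖f (x k)‖ = ‖x k - a‖ := fun k =>
    h.norm_apply (h.norm_sub_lt_and_norm_sub_one_le hxB hx0 hB0 k).1
  have hanti : Antitone fun k => ‖f (x k)‖ := antitone_nat_of_succ_le fun k => by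
    rw [hnorm, hnorm]
    linarith [h.norm_iterate_succ_le hxB hx0 hB0 k, norm_nonneg (x k - a)]
  have := norm_add_two_mul_finrank_le h.nonneg (h.isSecantStep hxB hx0 hB0) hanti n
  rwa [Module.finrank_fin_fun, hnorm, hnorm] at this

end Normalized

/-! ### R-order of convergence -/

/-- An error sequence that is squared, up to a constant, every `p` steps has R-order `2 ^ (1 / p)`.
The constant is taken `≥ 1`, so that it may be dropped from the bound for the error. -/
theorem hasROrder_of_norm_add_le {K : Type*} [NontriviallyNormedField K] {m : ℕ}
    {x : ℕ → Fin m → K} {a : Fin m → K} {p : ℕ} (hp : 0 < p) {c : ℝ} (hc : 1 ≤ c)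
    (h0 : c * ‖x 0 - a‖ ≤ 1 / 2) (hlin : ∀ n, ‖x (n + 1) - a‖ ≤ 1 / 2 * ‖x n - a‖)
    (hquad : ∀ n, ‖x (n + p) - a‖ ≤ c * ‖x n - a‖ ^ 2) :
    HasROrder x a ((2 : ℝ) ^ (1 / (p : ℝ))) := by
  have hc0 : 0 ≤ c := zero_le_one.trans hc
  have hgeom : ∀ n, ‖x n - a‖ ≤ (1 / 2) ^ n * ‖x 0 - a‖ := by
    intro n
    induction n with
    | zero => simp
    | succ n ih =>
      rw [pow_succ', mul_assoc]
      exact (hlin n).trans (by gcongr)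
  have hhalf : ∀ n, c * ‖x n - a‖ ≤ 1 / 2 := fun n =>
    le_trans (mul_le_mul_of_nonneg_left ((hgeom n).trans (mul_le_of_le_one_left (norm_nonneg _)
      (pow_le_one₀ (by norm_num) (by norm_num)))) hc0) h0
  have hpow : ∀ j i, c * ‖x (i + p * j) - a‖ ≤ (1 / 2) ^ 2 ^ j := by
    intro j
    induction j with
    | zero => intro i; simpa using hhalf i
    | succ j ih =>
      intro i
      rw [mul_add_one, ← add_assoc]
      calc c * ‖x (i + p * j + p) - a‖ ≤ c * (c * ‖x (i + p * j) - a‖ ^ 2) := by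
            gcongr; exact hquad _
        _ = (c * ‖x (i + p * j) - a‖) ^ 2 := by ring
        _ ≤ ((1 / 2) ^ 2 ^ j) ^ 2 := by gcongr; exact ih i
        _ = (1 / 2) ^ 2 ^ (j + 1) := by rw [← pow_mul, pow_succ]
  have hle : ∀ k, ‖x k - a‖ ≤ (1 / 2 : ℝ) ^ 2 ^ (k / p) := fun k => by
    have := hpow (k / p) (k % p)
    rw [Nat.mod_add_div] at this
    exact (le_mul_of_one_le_left (norm_nonneg _) hc).trans this
  refine ⟨?_, ?_⟩
  · rw [tendsto_iff_norm_sub_tendsto_zero]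
    refine squeeze_zero (fun _ => norm_nonneg _) hgeom ?_
    simpa using (tendsto_pow_atTop_nhds_zero_of_lt_one (r := (1 / 2 : ℝ)) (by norm_num)
      (by norm_num)).mul_const ‖x 0 - a‖
  · have hbound : ∀ k : ℕ, ‖x k - a‖ₑ ^ (1 / ((2 : ℝ) ^ (1 / (p : ℝ))) ^ k)
        ≤ ENNReal.ofReal ((1 / 2 : ℝ) ^ (1 / 2 : ℝ)) := by
      intro k
      have hμ : ((2 : ℝ) ^ (1 / (p : ℝ))) ^ k ≤ 2 * 2 ^ (k / p) := by
        rw [← Real.rpow_natCast, ← Real.rpow_mul (by norm_num), ← pow_succ', ← Real.rpow_natCast]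
        apply Real.rpow_le_rpow_of_exponent_le (by norm_num)
        rw [one_div_mul_eq_div, div_le_iff₀ (by exact_mod_cast hp)]
        exact_mod_cast (Nat.lt_mul_of_div_lt (Nat.lt_succ_self (k / p)) hp).le
      have hμ0 : 0 < ((2 : ℝ) ^ (1 / (p : ℝ))) ^ k := by positivity
      rw [← ofReal_norm, ENNReal.ofReal_rpow_of_nonneg (norm_nonneg _) (by positivity)]
      apply ENNReal.ofReal_le_ofReal
      calc _ ≤ ((1 / 2 : ℝ) ^ 2 ^ (k / p)) ^ (1 / ((2 : ℝ) ^ (1 / (p : ℝ))) ^ k) := by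
            gcongr
            exact hle k
        _ = (1 / 2 : ℝ) ^ ((2 : ℝ) ^ (k / p) * (1 / ((2 : ℝ) ^ (1 / (p : ℝ))) ^ k)) := by
            rw [← Real.rpow_natCast, ← Real.rpow_mul (by norm_num)]
            push_cast
            rfl
        _ ≤ (1 / 2 : ℝ) ^ (1 / 2 : ℝ) := by
            apply Real.rpow_le_rpow_of_exponent_ge (by norm_num) (by norm_num)
            rw [mul_one_div, div_le_div_iff₀ (by norm_num) hμ0]
            linarith
    refine (limsup_le_of_le (by isBoundedDefault) (Eventually.of_forall hbound)).trans_lt ?_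
    rw [ENNReal.ofReal_lt_one]
    exact Real.rpow_lt_one (by norm_num) (by norm_num) (by norm_num)

theorem theorem4 {K : Type*} [NontriviallyNormedField K] [IsUltrametricDist K] [CompleteSpace K]
    (m : ℕ) (hm : 1 ≤ m)
    (f : (Fin m → K) → (Fin m → K)) (xs : Fin m → K) (J : Matrix (Fin m) (Fin m) K)
    (hzero : f xs = 0)
    (hderiv : HasStrictFDerivAt f (LinearMap.toContinuousLinearMap (Matrix.toLin' J)) xs)
    (hinv : IsUnit J)
    (U : Set (Fin m → K)) (hU : U ∈ 𝓝 xs) (c₀ : ℝ) (hc₀ : 0 < c₀)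
    (hquad : ∀ x ∈ U, ∀ y ∈ U, ‖f x - f y - J.mulVec (x - y)‖ ≤ c₀ * ‖x - y‖ ^ 2) :
    ∃ η : ℝ, 0 < η ∧ ∃ δ : ℝ, 0 < δ ∧ ∀ (x : ℕ → Fin m → K) (B : ℕ → Matrix (Fin m) (Fin m) K),
      IsBroydenIteration f x B → ‖x 0 - xs‖ < η → ‖B 0 - J‖ < δ →
        (∀ n, IsUnit (B n)) ∧ HasROrder x xs ((2 : ℝ) ^ (1 / (2 * (m : ℝ)))) := by
  obtain ⟨r₀, hr₀, hball⟩ := Metric.mem_nhds_iff.1 hU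
  have hJ : IsUnit J.det := (Matrix.isUnit_iff_isUnit_det J).1 hinv
  have hJi : IsUnit J⁻¹ := (Matrix.isUnit_nonsing_inv_iff).2 hinv
  set c := max 1 (‖J⁻¹‖ * c₀) with hc
  have hc1 : 1 ≤ c := le_max_left _ _
  have hcpos : 0 < c := zero_lt_one.trans_le hc1
  set η := min r₀ (1 / (2 * c)) with hη
  have hcη : c * η ≤ 1 / 2 :=
    calc c * η ≤ c * (1 / (2 * c)) := by gcongr; exact min_le_right _ _
      _ = 1 / 2 := by field_simp
  have hnear : IsNearIdentity (fun z => J⁻¹.mulVec (f z)) xs c η := by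
    refine ⟨hcpos.le, hcη, by simp [hzero], fun x y hx hy => ?_⟩
    have hmem : ∀ z, ‖z - xs‖ < η → z ∈ U := fun z hz =>
      hball (mem_ball_iff_norm.2 (hz.trans_le (min_le_left _ _)))
    have hdec : J⁻¹.mulVec (f x) - J⁻¹.mulVec (f y) - (x - y)
        = J⁻¹.mulVec (f x - f y - J.mulVec (x - y)) := by
      rw [Matrix.mulVec_sub, Matrix.mulVec_sub, Matrix.inv_mulVec_mulVec_of_isUnit hinv]
    rw [hdec]
    calc _ ≤ ‖J⁻¹‖ * (c₀ * ‖x - y‖ ^ 2) :=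
          (Matrix.norm_mulVec_le_of_ultrametric _ _).trans
            (by gcongr; exact hquad x (hmem x hx) y (hmem y hy))
      _ = ‖J⁻¹‖ * c₀ * ‖x - y‖ ^ 2 := by ring
      _ ≤ c * ‖x - y‖ ^ 2 := by gcongr; exact le_max_right _ _
  refine ⟨η, lt_min hr₀ (by positivity), 1 / (2 * (‖J⁻¹‖ + 1)), by positivity,
    fun x B hxB hx0 hB0 => ?_⟩
  have hxB' := hxB.const_mul hJi
  have hB0' : ‖J⁻¹ * B 0 - 1‖ ≤ 1 / 2 := by
    have hdec : J⁻¹ * B 0 - 1 = J⁻¹ * (B 0 - J) := by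
      rw [Matrix.mul_sub, Matrix.nonsing_inv_mul _ hJ]
    rw [hdec]
    calc _ ≤ ‖J⁻¹‖ * ‖B 0 - J‖ := Matrix.norm_mul_le_of_ultrametric _ _
      _ ≤ (‖J⁻¹‖ + 1) * (1 / (2 * (‖J⁻¹‖ + 1))) := by gcongr; linarith
      _ = 1 / 2 := by field_simp
  refine ⟨fun n => ?_, ?_⟩
  · have h1 : IsUnit (J⁻¹ * B n) := Matrix.isUnit_of_norm_sub_one_lt
      ((hnear.norm_sub_lt_and_norm_sub_one_le hxB' hx0 hB0' n).2.trans_lt (by norm_num))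
    have h2 := hinv.mul h1
    rwa [← Matrix.mul_assoc, Matrix.mul_nonsing_inv _ hJ, Matrix.one_mul] at h2
  · have := hasROrder_of_norm_add_le (p := 2 * m) (by omega) hc1
      ((mul_le_mul_of_nonneg_left hx0.le hcpos.le).trans hcη)
      (hnear.norm_iterate_succ_le hxB' hx0 hB0') (hnear.norm_iterate_add_two_mul_le hxB' hx0 hB0')
    simpa using this
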